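/- There are a polynomial $p$ in two variables with real coefficients and a deterministic algorithm with the following property. Let $m\ge 0$, $B\ge 1$ and $k\ge 2$ be integers, let $f:\mathbb R^2\to\mathbb R$ and $g_i:\mathbb R^2\to\mathbb R$, $i=1,\dots,m$, be convex functions, and let $S:=\{y\in\mathbb R^2 : g_i(y)\le 0 \text{ for } i=1,\dots,m\}$. Let $\hat x_1^*,\dots,\hat x_{k-1}^*$ be $k-1$ best points for $\min\{f(\hat x):\hat x\in S\cap[-B,B]^2\cap\mathbb Z^2\}$, that is, for each $j=1,\dots,k-1$, the point $\hat x_j^*$ is a minimizer of $f$ over $(S\cap[-B,B]^2\cap\mathbb Z^2)\setminus\{\hat x_1^*,\dots,\hat x_{j-1}^*\}$. The algorithm receives $m$, $B$, $k$ and $\hat x_1^*,\dots,\hat x_{k-1}^*$, and has access to $f,g_1,\dots,g_m$ only through adaptively chosen evaluations: it repeatedly chooses a point $y\in\mathbb R^2$ and is told the values $f(y),g_1(y),\dots,g_m(y)$. After evaluating $f$ and $g_1,\dots,g_m$ at no more than $p(\ln B,k)$ points, it either (a) outputs a $k$-th best point $\hat x_k^*$, that is, a minimizer of $f$ over $(S\cap[-B,B]^2\cap\mathbb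 Z^2)\setminus\{\hat x_1^*,\dots,\hat x_{k-1}^*\}$, or (b) reports, correctly, that there is no such point. -/

import Mathlib

namespace KthBest

/-- The inclusion of `ℤ²` in `ℝ²`. -/
def toReal (z : ℤ × ℤ) : ℝ × ℝ := ((z.1 : ℝ), (z.2 : ℝ))

/-- `S = {y ∈ ℝ² : g i y ≤ 0 for all i}`. -/
def constraintSet {m : ℕ} (g : Fin m → ℝ × ℝ → ℝ) : Set (ℝ × ℝ) :=
  {y | ∀ i, g i y ≤ 0}

/-- The box `[-B, B]²`. -/
def box (B : ℕ) : Set (ℝ × ℝ) :=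
  Set.Icc (-(B : ℝ)) (B : ℝ) ×ˢ Set.Icc (-(B : ℝ)) (B : ℝ)

/-- The feasible integer points `S ∩ [-B, B]² ∩ ℤ²`. -/
def feasible {m : ℕ} (g : Fin m → ℝ × ℝ → ℝ) (B : ℕ) : Set (ℤ × ℤ) :=
  {z | toReal z ∈ constraintSet g ∩ box B}

/-- `z` minimizes `f` over the set `F` of integer points. -/
def IsArgmin (f : ℝ × ℝ → ℝ) (F : Set (ℤ × ℤ)) (z : ℤ × ℤ) : Prop :=
  z ∈ F ∧ ∀ w ∈ F, f (toReal z) ≤ f (toReal w)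

/-- `x 0, …, x (n - 1)` are (in this order) `n` best points of `F`: each `x j` minimizes `f`
over the points of `F` different from `x 0, …, x (j - 1)`. -/
def AreBestPoints (f : ℝ × ℝ → ℝ) (F : Set (ℤ × ℤ)) {n : ℕ} (x : Fin n → ℤ × ℤ) : Prop :=
  ∀ j, IsArgmin f (F \ {z | ∃ i < j, x i = z}) (x j)

/-- `z` is a next best point of `F` after `x 0, …, x (n - 1)`. -/
def IsNextBestPoint (f : ℝ × ℝ → ℝ) (F : Set (ℤ × ℤ)) {n : ℕ} (x : Fin n → ℤ × ℤ)
    (z : ℤ × ℤ) : Prop :=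
  IsArgmin f (F \ Set.range x) z

/-- A deterministic adaptive algorithm with results in `α` that has access to functions
`f, g 0, …, g (m - 1)` on `ℝ²` only by evaluating them. It either stops with an output, or
chooses a point of `ℝ²` and continues in dependence on the values of `f` and of
`g 0, …, g (m - 1)` at that point. -/
inductive EvalAlgorithm (m : ℕ) (α : Type) : Type
  | output (a : α) : EvalAlgorithm m α
  | evaluate (y : ℝ × ℝ) (next : ℝ → (Fin m → ℝ) → EvalAlgorithm m α) : EvalAlgorithm m α

namespace EvalAlgorithm

/-- The output of the algorithm on the functions `f` and `g`. -/
def run {m : ℕ} {α : Type} (f : ℝ × ℝ → ℝ) (g : Fin m → ℝ × ℝ → ℝ) : EvalAlgorithm m α → α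
  | output a => a
  | evaluate y next => run f g (next (f y) (fun i => g i y))

/-- The number of points at which the algorithm, run on `f` and `g`, evaluates these functions;
so each of `f, g 0, …, g (m - 1)` is evaluated this many times. -/
def numEvals {m : ℕ} {α : Type} (f : ℝ × ℝ → ℝ) (g : Fin m → ℝ × ℝ → ℝ) :
    EvalAlgorithm m α → ℕ
  | output _ => 0
  | evaluate y next => numEvals f g (next (f y) (fun i => g i y)) + 1

end EvalAlgorithm

end KthBest

/-! Rank points lexicographically by total constraint violation, then by `f`. Violation is convex
and vanishes exactly on the feasible set, so a lattice point of least rank outside the given points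
is a next best point if it is feasible, and otherwise no next best point exists. Removing the given
points cuts the lattice box into at most `k` lexicographic intervals, each closed under lattice
midpoints, and each is minimized separately.

In such a finite set `F`, Doignon's theorem (Helly number 4 for `ℤ²`) yields a centerpoint `u`: an
open half-plane with `u` on its boundary contains at most 3/4 of `F`
(`MidClosed.exists_centerpoint`). If `y` is better than `u`, so is every point of the segment from
`u` to `y` except `u`. That segment meets one of the two vertical lines at distance 1 from `u`, or
contains one of the vertical neighbours of `u`. On each line the better points form an interval,
found by bisection among `O(B ^ 2)` candidates (`Solvable.intervalSearch`). The better candidates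
have a convex hull that misses `u`; a separating functional puts all better points of `F` into one
such half-plane (`Detectable.cut`). So `O(log B)` evaluations discard a quarter of `F`, and `O(log
B)` rounds exhaust it, for `O(k (log B) ^ 2)` evaluations in all. -/

namespace KthBest

open Finset

/-! ### Composition of evaluation algorithms -/

namespace EvalAlgorithm

/-- Run an algorithm, then continue in dependence on its output. -/
def bind {m : ℕ} {α β : Type} : EvalAlgorithm m α → (α → EvalAlgorithm m β) → EvalAlgorithm m β
  | output a, k => k a
  | evaluate y next, k => evaluate y fun s t => bind (next s t) k

theorem run_bind {m : ℕ} {α β : Type} (f : ℝ × ℝ → ℝ) (g : Fin m → ℝ × ℝ → ℝ)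
    (A : EvalAlgorithm m α) (k : α → EvalAlgorithm m β) :
    (A.bind k).run f g = (k (A.run f g)).run f g := by
  induction A with
  | output a => rfl
  | evaluate y next ih => simpa [bind, run] using ih _ _

theorem numEvals_bind {m : ℕ} {α β : Type} (f : ℝ × ℝ → ℝ) (g : Fin m → ℝ × ℝ → ℝ)
    (A : EvalAlgorithm m α) (k : α → EvalAlgorithm m β) :
    (A.bind k).numEvals f g = A.numEvals f g + (k (A.run f g)).numEvals f g := by
  induction A with
  | output a => simp [bind, run, numEvals]
  | evaluate y next ih => simp [bind, run, numEvals, ih]; omega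

end EvalAlgorithm

/-- The functions `f` and `g i` are convex. -/
def ConvexData {m : ℕ} (f : ℝ × ℝ → ℝ) (g : Fin m → ℝ × ℝ → ℝ) : Prop :=
  ConvexOn ℝ Set.univ f ∧ ∀ i, ConvexOn ℝ Set.univ (g i)

/-- Some algorithm finds, for all convex data and with at most `n` evaluations, an output with
property `P`. -/
def Solvable {m : ℕ} {α : Type} (n : ℕ)
    (P : (ℝ × ℝ → ℝ) → (Fin m → ℝ × ℝ → ℝ) → α → Prop) : Prop :=
  ∃ A : EvalAlgorithm m α, ∀ f g, ConvexData f g → A.numEvals f g ≤ n ∧ P f g (A.run f g)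

namespace Solvable

variable {m : ℕ} {α β : Type}

theorem pure {P : (ℝ × ℝ → ℝ) → (Fin m → ℝ × ℝ → ℝ) → α → Prop} (n : ℕ) (a : α)
    (h : ∀ f g, ConvexData f g → P f g a) : Solvable n P :=
  ⟨.output a, fun f g hfg => ⟨Nat.zero_le _, h f g hfg⟩⟩

theorem bind {P : (ℝ × ℝ → ℝ) → (Fin m → ℝ × ℝ → ℝ) → α → Prop}
    {Q : (ℝ × ℝ → ℝ) → (Fin m → ℝ × ℝ → ℝ) → β → Prop} {n₁ n₂ : ℕ} (h₁ : Solvable n₁ P)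
    (h₂ : ∀ a, Solvable n₂ fun f g b => P f g a → Q f g b) : Solvable (n₁ + n₂) Q := by
  obtain ⟨A, hA⟩ := h₁
  choose k hk using h₂
  refine ⟨A.bind k, fun f g hfg => ?_⟩
  rw [EvalAlgorithm.run_bind, EvalAlgorithm.numEvals_bind]
  exact ⟨add_le_add (hA f g hfg).1 (hk _ f g hfg).1, (hk _ f g hfg).2 (hA f g hfg).2⟩

theorem map {P : (ℝ × ℝ → ℝ) → (Fin m → ℝ × ℝ → ℝ) → α → Prop}
    {Q : (ℝ × ℝ → ℝ) → (Fin m → ℝ × ℝ → ℝ) → β → Prop} {n : ℕ} (h₁ : Solvable n P)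
    (h₂ : ∀ a, ∃ b, ∀ f g, ConvexData f g → P f g a → Q f g b) : Solvable n Q := by
  choose b hb using h₂
  exact h₁.bind (n₂ := 0) fun a => pure 0 (b a) (hb a)

theorem mono {P : (ℝ × ℝ → ℝ) → (Fin m → ℝ × ℝ → ℝ) → α → Prop} {n n' : ℕ}
    (h : Solvable n P) (hn : n ≤ n') : Solvable n' P := by
  obtain ⟨A, hA⟩ := h
  exact ⟨A, fun f g hfg => ⟨(hA f g hfg).1.trans hn, (hA f g hfg).2⟩⟩

theorem weaken {P Q : (ℝ × ℝ → ℝ) → (Fin m → ℝ × ℝ → ℝ) → α → Prop} {n : ℕ}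
    (h : Solvable n P) (hPQ : ∀ f g a, ConvexData f g → P f g a → Q f g a) : Solvable n Q :=
  h.map fun a => ⟨a, fun f g hfg => hPQ f g a hfg⟩

theorem eval (y : ℝ × ℝ) :
    Solvable (m := m) 1 fun f g (a : ℝ × (Fin m → ℝ)) => a = (f y, fun i => g i y) :=
  ⟨.evaluate y fun s t => .output (s, t), fun f g _ => by
    simp [EvalAlgorithm.numEvals, EvalAlgorithm.run]⟩

end Solvable

/-! ### The lexicographic rank and its convexity -/

/-- The total violation of the constraints `g i y ≤ 0`. -/
noncomputable def violation {m : ℕ} (g : Fin m → ℝ × ℝ → ℝ) (y : ℝ × ℝ) : ℝ :=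
  ∑ i, max (g i y) 0

/-- Points are ranked by their total violation first, and then by `f`. -/
noncomputable def rank {m : ℕ} (f : ℝ × ℝ → ℝ) (g : Fin m → ℝ × ℝ → ℝ) (y : ℝ × ℝ) : ℝ ×ₗ ℝ :=
  toLex (violation g y, f y)

theorem violation_nonneg {m : ℕ} (g : Fin m → ℝ × ℝ → ℝ) (y : ℝ × ℝ) : 0 ≤ violation g y :=
  Finset.sum_nonneg fun _ _ => le_max_right _ _

theorem violation_eq_zero_iff {m : ℕ} {g : Fin m → ℝ × ℝ → ℝ} {y : ℝ × ℝ} :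
    violation g y = 0 ↔ y ∈ constraintSet g := by
  rw [violation, Finset.sum_eq_zero_iff_of_nonneg fun _ _ => le_max_right _ _]
  simp [constraintSet]

theorem convexOn_violation {m : ℕ} {g : Fin m → ℝ × ℝ → ℝ}
    (hg : ∀ i, ConvexOn ℝ Set.univ (g i)) : ConvexOn ℝ Set.univ (violation g) := by
  have h : ∀ s : Finset (Fin m), ConvexOn ℝ Set.univ fun y => ∑ i ∈ s, max (g i y) 0 := by
    intro s
    induction s using Finset.induction_on with
    | empty => simpa using convexOn_const (0 : ℝ) convex_univ
    | insert a s ha ih =>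
      simp only [Finset.sum_insert ha]
      exact ((hg a).sup (convexOn_const 0 convex_univ)).add ih
  exact h _

section Rank

variable {m : ℕ} {f : ℝ × ℝ → ℝ} {g : Fin m → ℝ × ℝ → ℝ}

/-- Stronger than quasiconvexity: strictness rules out plateaus above the minimum on a line, so
comparing two neighbours shows on which side nothing better can lie. -/
theorem rank_lt_of_mem_openSegment (h : ConvexData f g) {a b w : ℝ × ℝ}
    (hw : w ∈ openSegment ℝ a b) (hab : rank f g b < rank f g a) : rank f g w < rank f g a := by
  obtain ⟨s, t, hs, ht, hst, rfl⟩ := hw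
  have h1 := (convexOn_violation h.2).2 (Set.mem_univ a) (Set.mem_univ b) hs.le ht.le hst
  have h2 := h.1.2 (Set.mem_univ a) (Set.mem_univ b) hs.le ht.le hst
  simp only [rank, Prod.Lex.toLex_lt_toLex, smul_eq_mul] at *
  obtain rfl : s = 1 - t := by linarith
  rcases hab with hab | ⟨hab, hab'⟩
  · left
    nlinarith
  · rw [hab] at h1
    rcases h1.lt_or_eq with h3 | h3
    · left
      linarith
    · right
      constructor
      · linarith
      · nlinarith

theorem rank_le_of_mem_openSegment (h : ConvexData f g) {a b w : ℝ × ℝ}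
    (hw : w ∈ openSegment ℝ a b) (hab : rank f g b ≤ rank f g a) : rank f g w ≤ rank f g a := by
  rcases hab.lt_or_eq with hab | hab
  · exact (rank_lt_of_mem_openSegment h hw hab).le
  obtain ⟨s, t, hs, ht, hst, rfl⟩ := hw
  have h1 := (convexOn_violation h.2).2 (Set.mem_univ a) (Set.mem_univ b) hs.le ht.le hst
  have h2 := h.1.2 (Set.mem_univ a) (Set.mem_univ b) hs.le ht.le hst
  have h3 : (violation g b, f b) = (violation g a, f a) := hab
  rw [Prod.mk.injEq] at h3
  rw [h3.1, ← add_smul, hst, one_smul] at h1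
  rw [h3.2, ← add_smul, hst, one_smul] at h2
  simp only [rank, Prod.Lex.toLex_le_toLex]
  rcases h1.lt_or_eq with h4 | h4
  exacts [.inl h4, .inr ⟨h4, h2⟩]

theorem rank_lt_of_mem_openSegment_of_lt (h : ConvexData f g) {a b w : ℝ × ℝ} {c : ℝ ×ₗ ℝ}
    (hw : w ∈ openSegment ℝ a b) (ha : rank f g a < c) (hb : rank f g b < c) :
    rank f g w < c := by
  rcases le_total (rank f g b) (rank f g a) with hab | hab
  · exact (rank_le_of_mem_openSegment h hw hab).trans_lt ha
  · exact (rank_le_of_mem_openSegment h (openSegment_symm ℝ a b ▸ hw) hab).trans_lt hb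

theorem convex_rank_lt (h : ConvexData f g) (c : ℝ ×ₗ ℝ) : Convex ℝ {y | rank f g y < c} :=
  convex_iff_openSegment_subset.2 fun _ ha _ hb _ hw =>
    rank_lt_of_mem_openSegment_of_lt h hw ha hb

end Rank

theorem Solvable.compare {m : ℕ} (y z : ℝ × ℝ) :
    Solvable (m := m) 2 fun f g (b : Prop) => b ↔ rank f g y < rank f g z :=
  (eval y).bind (n₂ := 1) fun a => (eval z).map fun b =>
    ⟨toLex (∑ i, max (a.2 i) 0, a.1) < toLex (∑ i, max (b.2 i) 0, b.1), by
      rintro f g - rfl rfl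
      rfl⟩

theorem Solvable.feasible {m : ℕ} (y : ℝ × ℝ) :
    Solvable (m := m) 1 fun _ g (b : Prop) => b ↔ y ∈ constraintSet g :=
  (eval y).map fun a => ⟨∀ i, a.2 i ≤ 0, by
    rintro f g - rfl
    rfl⟩

/-! ### Bisection along a line -/

section LineSearch

variable {m : ℕ}

/-- Bisection for the end of a prefix. Monotonicity is assumed inside the property because it
depends on the unknown `f` and `g`. -/
theorem Solvable.prefixSearch (u : ℝ × ℝ) (s : ℕ) (q : ℕ → ℝ × ℝ) :
    Solvable (m := m) (2 * (s + 1)) fun f g (c : ℕ) =>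
      (∀ i j, i ≤ j → rank f g (q j) < rank f g u → rank f g (q i) < rank f g u) →
      ∀ i < 2 ^ s, rank f g (q i) < rank f g u ↔ i < c := by
  induction s generalizing q with
  | zero =>
    refine (Solvable.compare (q 0) u).map fun b => ?_
    by_cases hb : b
    · exact ⟨1, fun f g _ h _ i hi => by simp_all⟩
    · exact ⟨0, fun f g _ h _ i hi => by simp_all⟩
  | succ s ih =>
    rw [show 2 * (s + 1 + 1) = 2 + 2 * (s + 1) by ring]
    refine (Solvable.compare (q (2 ^ s)) u).bind fun b => ?_
    by_cases hb : b
    · refine (ih fun i => q (2 ^ s + i)).map fun c => ⟨2 ^ s + c, fun f g _ h hbq hm i hi => ?_⟩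
      have hb' := hbq.1 hb
      rcases lt_or_ge i (2 ^ s) with hi' | hi'
      · exact iff_of_true (hm _ _ hi'.le hb') (by omega)
      · have := h (fun i j hij => hm _ _ (by omega)) (i - 2 ^ s) (by rw [pow_succ] at hi; omega)
        rw [Nat.add_sub_cancel' hi'] at this
        rw [this]
        omega
    · refine (ih q).map fun c => ⟨min c (2 ^ s), fun f g _ h hbq hm i hi => ?_⟩
      have hb' := fun h => hb (hbq.2 h)
      rcases lt_or_ge i (2 ^ s) with hi' | hi'
      · rw [h hm i hi']
        omega
      · exact iff_of_false (fun h => hb' (hm _ _ hi' h)) (by omega)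

/-- The points `q i` lie on a line in the order of their indices. -/
def Ordered (q : ℤ → ℝ × ℝ) : Prop :=
  ∀ i j k, i < j → j < k → q j ∈ openSegment ℝ (q i) (q k)

theorem rank_lt_of_between {f : ℝ × ℝ → ℝ} {g : Fin m → ℝ × ℝ → ℝ} (h : ConvexData f g)
    {q : ℤ → ℝ × ℝ} (hq : Ordered q) {c : ℝ ×ₗ ℝ} {i j k : ℤ} (hij : i ≤ j) (hjk : j ≤ k)
    (hi : rank f g (q i) < c) (hk : rank f g (q k) < c) : rank f g (q j) < c := by
  rcases hij.eq_or_lt with rfl | hij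
  · exact hi
  rcases hjk.eq_or_lt with rfl | hjk
  · exact hk
  exact rank_lt_of_mem_openSegment_of_lt h (hq _ _ _ hij hjk) hi hk

/-- The indices better than `u` form an interval. Once the middle index lies in it, a prefix search
in each direction finds its ends; before that, comparing the middle with its left neighbour discards
one half. -/
theorem Solvable.intervalSearch (u : ℝ × ℝ) (q : ℤ → ℝ × ℝ) (hq : Ordered q) (s : ℕ) (lo : ℤ) :
    Solvable (m := m) (8 * (s + 1)) fun f g (S : Set ℤ) =>
      ∀ i, lo ≤ i → i < lo + 2 ^ s → (rank f g (q i) < rank f g u ↔ i ∈ S) := by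
  induction s generalizing lo with
  | zero =>
    refine ((Solvable.compare (q lo) u).map fun b => ⟨{_i | b}, ?_⟩).mono (by omega)
    intro f g _ h i hi hi'
    obtain rfl : i = lo := by simp at hi'; omega
    exact h.symm
  | succ s ih =>
    have h2 : (2 : ℤ) ^ (s + 1) = 2 ^ s + 2 ^ s := by ring
    have h2' : (2 : ℕ) ^ (s + 1) = 2 ^ s + 2 ^ s := by ring
    have h3 : ((2 ^ s : ℕ) : ℤ) = 2 ^ s := by norm_cast
    rw [show 8 * (s + 1 + 1) = 2 + (8 * s + 14) by ring]
    set mid := lo + 2 ^ s with hmid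
    refine (Solvable.compare (q mid) u).bind fun b => ?_
    by_cases hb : b
    · refine Solvable.mono (n := 2 * (s + 1 + 1) + 2 * (s + 1 + 1)) ?_ (by omega)
      refine (Solvable.prefixSearch u (s + 1) fun i : ℕ => q (mid + i)).bind fun c₁ => ?_
      refine (Solvable.prefixSearch u (s + 1) fun i : ℕ => q (mid - i)).map fun c₂ => ?_
      refine ⟨{i | mid - c₂ < i ∧ i < mid + c₁}, fun f g hfg h₂ h₁ hbq i hi hi' => ?_⟩
      have hm := hbq.1 hb
      specialize h₁ fun i j hij hj =>
        rank_lt_of_between hfg hq (i := mid) (by omega) (by omega) hm hj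
      specialize h₂ fun i j hij hj =>
        rank_lt_of_between hfg hq (k := mid) (by omega) (by omega) hj hm
      have h₁0 := (h₁ 0 (by positivity)).1 (by simpa using hm)
      have h₂0 := (h₂ 0 (by positivity)).1 (by simpa using hm)
      rcases le_total mid i with hmi | hmi
      · have := h₁ (i - mid).toNat (by omega)
        rw [show mid + ((i - mid).toNat : ℤ) = i by omega] at this
        rw [this]
        show _ ↔ _ ∧ _
        omega
      · have := h₂ (mid - i).toNat (by omega)
        rw [show mid - ((mid - i).toNat : ℤ) = i by omega] at this
        rw [this]
        show _ ↔ _ ∧ _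
        omega
    · refine Solvable.mono (n := 2 + 8 * (s + 1)) ?_ (by omega)
      refine (Solvable.compare (q (mid - 1)) (q mid)).bind fun b' => ?_
      by_cases hb' : b'
      · refine (ih lo).map fun S => ⟨S ∩ {i | i < mid}, fun f g hfg hS hbq' hbq i hi hi' => ?_⟩
        have hm : rank f g u ≤ rank f g (q mid) := not_lt.1 fun h => hb (hbq.2 h)
        have hm' := hbq'.1 hb'
        rcases lt_or_ge i mid with hlt | hge
        · rw [hS i hi hlt]
          exact (and_iff_left hlt).symm
        · refine iff_of_false (fun h => ?_) fun h => absurd h.2 (not_lt.2 hge)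
          exact lt_irrefl _ (rank_lt_of_between hfg hq (sub_one_lt mid).le hge hm'
            (h.trans_le hm))
      · refine (ih mid).map fun S => ⟨S ∩ {i | mid ≤ i}, fun f g hfg hS hbq' hbq i hi hi' => ?_⟩
        have hm : rank f g u ≤ rank f g (q mid) := not_lt.1 fun h => hb (hbq.2 h)
        have hm' := fun h => hb' (hbq'.2 h)
        rcases lt_or_ge i mid with hlt | hge
        · refine iff_of_false (fun h => ?_) fun h => absurd h.2 (not_le.2 hlt)
          have hi := h.trans_le hm
          rcases (Int.le_sub_one_of_lt hlt).eq_or_lt with rfl | hlt'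
          · exact hm' hi
          -- A better point left of `mid - 1` would make `mid - 1` strictly better than `mid`.
          · refine hm' (rank_lt_of_mem_openSegment hfg (b := q i) ?_ hi)
            rw [openSegment_symm]
            exact hq _ _ _ hlt' (sub_one_lt mid)
        · rw [hS i hge (by omega)]
          exact (and_iff_left hge).symm

/-- With `n` evaluations one can find out which points of `Q` are better than `u`. -/
def Detectable (m : ℕ) (u : ℝ × ℝ) (Q : Set (ℝ × ℝ)) (n : ℕ) : Prop :=
  Solvable (m := m) n fun f g (S : Set (ℝ × ℝ)) => S = {p ∈ Q | rank f g p < rank f g u}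

theorem Detectable.union {u : ℝ × ℝ} {Q₁ Q₂ : Set (ℝ × ℝ)} {n₁ n₂ : ℕ}
    (h₁ : Detectable m u Q₁ n₁) (h₂ : Detectable m u Q₂ n₂) :
    Detectable m u (Q₁ ∪ Q₂) (n₁ + n₂) :=
  Solvable.bind h₁ fun S₁ => Solvable.map h₂ fun S₂ => ⟨S₁ ∪ S₂, by
    rintro f g - rfl rfl
    ext p
    simp only [Set.mem_union, Set.mem_ofPred_eq]
    tauto⟩

theorem detectable_singleton (u p : ℝ × ℝ) : Detectable m u {p} 2 :=
  (Solvable.compare p u).map fun b => ⟨{q | q = p ∧ b}, by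
    intro f g _ h
    ext q
    simp only [Set.mem_ofPred_eq, Set.mem_singleton_iff]
    constructor
    · rintro ⟨rfl, hb⟩
      exact ⟨rfl, h.1 hb⟩
    · rintro ⟨rfl, hb⟩
      exact ⟨rfl, h.2 hb⟩⟩

/-- The enumeration runs over all of `ℤ`, beyond `T`, so that `Ordered` holds without range
conditions. -/
theorem exists_strictMono_enum (T : Finset ℝ) :
    ∃ τ : ℤ → ℝ, StrictMono τ ∧ ∀ t ∈ T, ∃ i : ℤ, 0 ≤ i ∧ i < #T ∧ τ i = t := by
  induction T using Finset.induction_on_max with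
  | empty => exact ⟨fun i => i, Int.cast_strictMono, by simp⟩
  | insert a s hs ih =>
    obtain ⟨τ, hτ, h⟩ := ih
    have ha : a ∉ s := fun h => lt_irrefl _ (hs a h)
    rcases s.eq_empty_or_nonempty with rfl | hne
    · refine ⟨fun i => a + i, fun i j hij => by simpa using hij, fun t ht => ⟨0, ?_⟩⟩
      simp_all
    have hlt : ∀ i < (#s : ℤ), τ i < a := by
      intro i hi
      have hcard : Finset.image τ (Finset.Ico 0 (#s : ℤ)) = s := by
        symm
        apply Finset.eq_of_subset_of_card_le
        · intro t ht
          obtain ⟨i, h0, h1, rfl⟩ := h t ht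
          exact Finset.mem_image_of_mem _ (Finset.mem_Ico.2 ⟨h0, h1⟩)
        · exact Finset.card_image_le.trans (by simp)
      have hpos := Finset.card_pos.2 hne
      have : τ (#s - 1 : ℤ) ∈ s := by
        rw [← hcard]
        refine Finset.mem_image_of_mem _ (Finset.mem_Ico.2 ⟨?_, ?_⟩)
        · rw [hcard]; omega
        · rw [hcard]; omega
      exact (hτ.monotone (by omega)).trans_lt (hs _ this)
    refine ⟨fun i => if i < #s then τ i else a + (i - #s : ℤ), ?_, ?_⟩
    · intro i j hij
      dsimp only
      split_ifs with h1 h2 h2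
      · exact hτ hij
      · have := hlt i h1
        have h3 : (0 : ℝ) ≤ ((j - #s : ℤ) : ℝ) := by
          exact_mod_cast (by omega : (0 : ℤ) ≤ j - #s)
        linarith
      · omega
      · have : ((i - #s : ℤ) : ℝ) < ((j - #s : ℤ) : ℝ) := by
          exact_mod_cast (by omega : i - (#s : ℤ) < j - #s)
        linarith
    · intro t ht
      rw [Finset.card_insert_of_notMem ha]
      rcases Finset.mem_insert.1 ht with rfl | ht
      · exact ⟨#s, by simp⟩
      · obtain ⟨i, h0, h1, rfl⟩ := h t ht
        exact ⟨i, h0, by push_cast; omega, if_pos h1⟩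

theorem detectable_vertical (u : ℝ × ℝ) (x : ℝ) (T : Finset ℝ) (s : ℕ) (hT : #T ≤ 2 ^ s) :
    Detectable m u ((fun t => (x, t)) '' (T : Set ℝ)) (8 * (s + 1)) := by
  obtain ⟨τ, hτ, h⟩ := exists_strictMono_enum T
  have hq : Ordered fun i => (x, τ i) := by
    intro i j k hij hjk
    rw [← Prod.image_mk_openSegment_right]
    refine Set.mem_image_of_mem _ ?_
    rw [openSegment_eq_Ioo (hτ (hij.trans hjk))]
    exact ⟨hτ hij, hτ hjk⟩
  refine (Solvable.intervalSearch u _ hq s 0).map fun S =>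
    ⟨{p | ∃ i ∈ S, τ i ∈ T ∧ 0 ≤ i ∧ i < #T ∧ p = (x, τ i)}, fun f g _ hS => ?_⟩
  have h2 : (#T : ℤ) ≤ 2 ^ s := by exact_mod_cast hT
  ext p
  constructor
  · rintro ⟨i, hi, hiT, h0, h1, rfl⟩
    exact ⟨⟨_, hiT, rfl⟩, (hS i h0 (by omega)).2 hi⟩
  · rintro ⟨⟨t, ht, rfl⟩, hlt⟩
    obtain ⟨i, h0, h1, rfl⟩ := h t ht
    exact ⟨i, (hS i h0 (by omega)).1 hlt, ht, h0, h1, rfl⟩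

end LineSearch

/-! ### Doignon's theorem and lattice centerpoints -/

/-- A set of lattice points that contains every lattice midpoint of two of its points. -/
def MidClosed (F : Finset (ℤ × ℤ)) : Prop :=
  ∀ p ∈ F, ∀ q ∈ F, ∀ r, r + r = p + q → r ∈ F

theorem MidClosed.filter_lt {F : Finset (ℤ × ℤ)} (hF : MidClosed F) (φ : ℤ × ℤ →+ ℝ) (c : ℝ) :
    MidClosed {y ∈ F | φ y < c} := by
  intro p hp q hq r hr
  rw [Finset.mem_filter] at *
  refine ⟨hF p hp.1 q hq.1 r hr, ?_⟩
  have := congrArg φ hr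
  simp only [map_add] at this
  linarith [hp.2, hq.2]

theorem exists_same_parity {ι : Type} {J : Finset ι} (hJ : 4 < #J) (y : ι → ℤ × ℤ) :
    ∃ i ∈ J, ∃ j ∈ J, i ≠ j ∧ ∃ r, r + r = y i + y j := by
  obtain ⟨i, hi, j, hj, hij, h⟩ := Finset.exists_ne_map_eq_of_card_lt_of_maps_to
    (s := J) (t := (Finset.univ : Finset (ZMod 2 × ZMod 2)))
    (f := fun i => (((y i).1 : ZMod 2), ((y i).2 : ZMod 2))) (by simpa using hJ)
    (fun _ _ => Finset.mem_univ _)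
  simp only [Prod.mk.injEq] at h
  have h1 := (ZMod.intCast_eq_intCast_iff_dvd_sub _ _ 2).1 h.1
  have h2 := (ZMod.intCast_eq_intCast_iff_dvd_sub _ _ 2).1 h.2
  refine ⟨i, hi, j, hj, hij, (((y i).1 + (y j).1) / 2, ((y i).2 + (y j).2) / 2), ?_⟩
  ext
  · simp only [Prod.fst_add]
    omega
  · simp only [Prod.snd_add]
    omega

section Helly

variable {ι : Type} [DecidableEq ι] {F : Finset (ℤ × ℤ)}

/-- For a minimal infeasible system, relax the bounds one at a time as far as infeasibility allows.
Each bound is then attained at a point strictly satisfying all the others; later relaxations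
preserve this. -/
theorem exists_saturated_bounds {J : Finset ι} (φ : ι → ℤ × ℤ →+ ℝ) (γ : ι → ℝ)
    (hJ : ¬ ∃ x ∈ F, ∀ i ∈ J, φ i x < γ i)
    (hmin : ∀ i ∈ J, ∃ x ∈ F, ∀ j ∈ J.erase i, φ j x < γ j) :
    ∀ s ⊆ J, ∃ γ' : ι → ℝ, (∀ i, γ i ≤ γ' i) ∧ (¬ ∃ x ∈ F, ∀ i ∈ J, φ i x < γ' i) ∧
      ∀ i ∈ s, ∃ y ∈ F, φ i y = γ' i ∧ ∀ j ∈ J, j ≠ i → φ j y < γ' j := by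
  intro s
  induction s using Finset.induction_on with
  | empty => exact fun _ => ⟨γ, fun _ => le_rfl, hJ, by simp⟩
  | insert a s ha ih =>
    intro hs
    obtain ⟨γ', hγ, hno, hy⟩ := ih ((Finset.subset_insert _ _).trans hs)
    have haJ := hs (Finset.mem_insert_self _ _)
    obtain ⟨x₁, hx₁, hx₁'⟩ := hmin a haJ
    obtain ⟨x₀, hx₀, hx₀min⟩ := Finset.exists_min_image
      {x ∈ F | ∀ j ∈ J.erase a, φ j x < γ' j} (φ a)
      ⟨x₁, Finset.mem_filter.2 ⟨hx₁, fun j hj => (hx₁' j hj).trans_le (hγ j)⟩⟩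
    rw [Finset.mem_filter] at hx₀
    have hle : γ' a ≤ φ a x₀ := by
      by_contra! hlt
      refine hno ⟨x₀, hx₀.1, fun i hi => ?_⟩
      rcases eq_or_ne i a with rfl | hia
      exacts [hlt, hx₀.2 i (Finset.mem_erase.2 ⟨hia, hi⟩)]
    have hle' : ∀ i, γ' i ≤ Function.update γ' a (φ a x₀) i := by
      intro i
      rcases eq_or_ne i a with rfl | hia
      · simpa using hle
      · simp [hia]
    refine ⟨Function.update γ' a (φ a x₀), fun i => (hγ i).trans (hle' i), ?_, ?_⟩
    · rintro ⟨x, hx, hxJ⟩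
      have h1 := hx₀min x (Finset.mem_filter.2 ⟨hx, fun j hj => by
        rw [Finset.mem_erase] at hj
        simpa [hj.1] using hxJ j hj.2⟩)
      have h2 := hxJ a haJ
      rw [Function.update_self] at h2
      exact absurd h1 (not_le.2 h2)
    · intro i hi
      rcases Finset.mem_insert.1 hi with rfl | hi
      · refine ⟨x₀, hx₀.1, by simp, fun j hj hja => ?_⟩
        simpa [hja] using hx₀.2 j (Finset.mem_erase.2 ⟨hja, hj⟩)
      · have hia : i ≠ a := fun h => ha (h ▸ hi)
        obtain ⟨y, hyF, hyi, hyj⟩ := hy i hi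
        exact ⟨y, hyF, by simpa [hia] using hyi, fun j hj hji => (hyj j hj hji).trans_le (hle' j)⟩

/-- Doignon's theorem in the plane: the Helly number of the lattice `ℤ²` is `4`. -/
theorem exists_lattice_point_of_helly (hF : MidClosed F) (φ : ι → ℤ × ℤ →+ ℝ) (γ : ι → ℝ)
    (J : Finset ι) (h : ∀ K ⊆ J, #K ≤ 4 → ∃ x ∈ F, ∀ i ∈ K, φ i x < γ i) :
    ∃ x ∈ F, ∀ i ∈ J, φ i x < γ i := by
  induction J using Finset.strongInduction with
  | H J ih =>
    rcases le_or_gt #J 4 with hc | hc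
    · exact h J subset_rfl hc
    by_contra hno
    obtain ⟨γ', -, hno', hy⟩ := exists_saturated_bounds φ γ hno (fun i hi =>
      ih (J.erase i) (Finset.erase_ssubset hi) fun K hK =>
        h K (hK.trans (Finset.erase_subset _ _))) J subset_rfl
    choose! y hyF hyi hyj using hy
    obtain ⟨i, hi, j, hj, hij, r, hr⟩ := exists_same_parity hc y
    -- Two of more than four witnesses agree modulo 2. Each constraint holds weakly at both and is
    -- tight at no more than one, so it is strict at their midpoint.
    refine hno' ⟨r, hF _ (hyF i hi) _ (hyF j hj) r hr, fun k hk => ?_⟩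
    have hrk := congrArg (φ k) hr
    simp only [map_add] at hrk
    have hle : ∀ l ∈ J, φ k (y l) ≤ γ' k := fun l hl => by
      rcases eq_or_ne k l with rfl | hkl
      exacts [(hyi k hk).le, (hyj l hl k hk hkl).le]
    rcases eq_or_ne k i with rfl | hki
    · linarith [hyj j hj k hk hij, hle k hi]
    · linarith [hyj i hi k hk hki, hle j hj]

end Helly

/-- A lattice centerpoint. -/
theorem MidClosed.exists_centerpoint {F : Finset (ℤ × ℤ)} (hF : MidClosed F)
    (hne : F.Nonempty) :
    ∃ u ∈ F, ∀ φ : ℤ × ℤ →+ ℝ, 4 * #{y ∈ F | φ y < φ u} ≤ 3 * #F := by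
  by_contra! hcon
  choose! φ hφ using hcon
  obtain ⟨x, hx, hxF⟩ := exists_lattice_point_of_helly hF φ (fun u => φ u u) F (by
    -- Each half-plane misses fewer than a quarter of `F`, so four of them cannot miss all of it.
    intro K hK hKc
    by_contra! hno
    have hsub : F ⊆ K.biUnion fun u => {y ∈ F | ¬ φ u y < φ u u} := by
      intro x hx
      obtain ⟨i, hi, hix⟩ := hno x hx
      exact Finset.mem_biUnion.2 ⟨i, hi, Finset.mem_filter.2 ⟨hx, not_lt.2 hix⟩⟩
    have h1 := Finset.card_le_card hsub
    have h2 : ∀ u ∈ K, 4 * #{y ∈ F | ¬ φ u y < φ u u} + 1 ≤ #F := fun u hu => by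
      have h3 := hφ u (hK hu)
      have h4 := Finset.card_filter_add_card_filter_not (s := F) fun y => φ u y < φ u u
      omega
    have h3 : ∑ u ∈ K, (4 * #{y ∈ F | ¬ φ u y < φ u u} + 1) ≤ #K * #F := by
      simpa using Finset.sum_le_card_nsmul K _ _ h2
    rw [Finset.sum_add_distrib, ← Finset.mul_sum] at h3
    have h4 := Finset.card_biUnion_le (s := K) (t := fun u => {y ∈ F | ¬ φ u y < φ u u})
    have h5 : #K * #F ≤ 4 * #F := Nat.mul_le_mul_right _ hKc
    have h6 : K.Nonempty := by
      rw [Finset.nonempty_iff_ne_empty]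
      rintro rfl
      obtain ⟨x, hx⟩ := hne
      simpa using hno x hx
    have h7 := Finset.card_pos.2 h6
    simp only [Finset.sum_const, smul_eq_mul, mul_one] at h3
    omega)
  exact lt_irrefl _ (hxF x hx)

/-- The inclusion of `ℤ²` in `ℝ²` as a homomorphism. -/
def toRealHom : ℤ × ℤ →+ ℝ × ℝ where
  toFun := toReal
  map_zero' := by simp [toReal]
  map_add' p q := by simp [toReal]

/-- The lattice points with coordinates of absolute value at most `B`. -/
noncomputable def latticeBox (B : ℕ) : Finset (ℤ × ℤ) := Finset.Icc (-(B : ℤ)) B ×ˢ Finset.Icc (-(B : ℤ)) B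

/-! ### Cutting at a centerpoint -/

section Minimize

variable {m : ℕ}

theorem exists_separating_functional {f : ℝ × ℝ → ℝ} {g : Fin m → ℝ × ℝ → ℝ}
    (hfg : ConvexData f g) (u : ℤ × ℤ) (S : Set (ℝ × ℝ)) (hfin : S.Finite)
    (hS : ∀ p ∈ S, rank f g p < rank f g (toReal u)) :
    ∃ φ : ℤ × ℤ →+ ℝ, ∀ y, (∃ t > (0 : ℝ), toReal u + t • (toReal y - toReal u) ∈ S) →
      φ y < φ u := by
  have hu : toReal u ∉ convexHull ℝ S := fun h =>
    lt_irrefl (rank f g (toReal u)) (convexHull_min hS (convex_rank_lt hfg _) h)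
  obtain ⟨ℓ, c, hℓu, hℓ⟩ := geometric_hahn_banach_point_closed (convex_convexHull ℝ S)
    (hfin.isClosed_convexHull ℝ) hu
  refine ⟨-((ℓ : ℝ × ℝ →ₗ[ℝ] ℝ).toAddMonoidHom.comp toRealHom), ?_⟩
  rintro y ⟨t, ht, hy⟩
  have h1 := hℓ _ (subset_convexHull ℝ S hy)
  simp only [map_add, map_smul, map_sub, smul_eq_mul] at h1
  show -ℓ (toReal y) < -ℓ (toReal u)
  have : 0 < t * (ℓ (toReal y) - ℓ (toReal u)) := by linarith
  linarith [(mul_pos_iff_of_pos_left ht).1 this]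

/-- With `n` evaluations one can find a set of at most three quarters of the points of `F` that
contains all points of `F` better than the centerpoint `u`. -/
theorem Detectable.cut {F : Finset (ℤ × ℤ)} (hF : MidClosed F) {u : ℤ × ℤ}
    (hu : ∀ φ : ℤ × ℤ →+ ℝ, 4 * #{y ∈ F | φ y < φ u} ≤ 3 * #F) {Q : Set (ℝ × ℝ)}
    (hfin : Q.Finite) (hQ : ∀ y ∈ F, y ≠ u →
      ∃ t : ℝ, 0 < t ∧ t ≤ 1 ∧ toReal u + t • (toReal y - toReal u) ∈ Q) {n : ℕ}
    (h : Detectable m (toReal u) Q n) :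
    Solvable (m := m) n fun f g (F' : Finset (ℤ × ℤ)) => MidClosed F' ∧ F' ⊆ F ∧
      4 * #F' ≤ 3 * #F ∧ ∀ y ∈ F, rank f g (toReal y) < rank f g (toReal u) → y ∈ F' := by
  refine Solvable.map h fun S => ?_
  by_cases hS : ∃ φ : ℤ × ℤ →+ ℝ,
      ∀ y, (∃ t > (0 : ℝ), toReal u + t • (toReal y - toReal u) ∈ S) → φ y < φ u
  · obtain ⟨φ, hφ⟩ := hS
    refine ⟨{y ∈ F | φ y < φ u}, fun f g hfg hS => ⟨hF.filter_lt φ _, Finset.filter_subset _ _,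
      hu φ, fun y hy hlt => Finset.mem_filter.2 ⟨hy, hφ y ?_⟩⟩⟩
    obtain ⟨t, ht, ht1, htQ⟩ := hQ y hy (by rintro rfl; exact lt_irrefl _ hlt)
    refine ⟨t, ht, hS ▸ ⟨htQ, ?_⟩⟩
    rcases ht1.eq_or_lt with rfl | ht1
    · simpa using hlt
    · refine rank_lt_of_mem_openSegment hfg ⟨1 - t, t, by linarith, ht, by ring, ?_⟩ hlt
      module
  -- For convex data a functional always exists, so the default `∅` is never reached.
  · refine ⟨∅, fun f g hfg h => absurd ?_ hS⟩
    refine exists_separating_functional hfg u S (hfin.subset ?_) ?_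
    · rw [h]
      exact Set.sep_subset _ _
    · rw [h]
      exact fun p hp => hp.2

/-- The slopes of the lines through two points of the lattice box. -/
noncomputable def slopes (B : ℕ) : Finset ℝ :=
  (Finset.Icc 1 (2 * B) ×ˢ Finset.Icc (-(2 * B : ℤ)) (2 * B)).image fun p => (p.2 : ℝ) / (p.1 : ℝ)

theorem card_slopes_le (B : ℕ) : #(slopes B) ≤ 2 * B * (4 * B + 1) := by
  refine Finset.card_image_le.trans ?_
  rw [Finset.card_product, Nat.card_Icc, Int.card_Icc]
  refine Nat.mul_le_mul (by omega) (by omega)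

/-- Scaling `y - u` by the inverse of its horizontal distance (vertical distance if the former is 0)
keeps the point on the segment. On the lines at distance 1 only the heights `u.2 + slope` occur. -/
theorem exists_detectable_directions {B s : ℕ} (hs : 2 * B * (4 * B + 1) ≤ 2 ^ s) {u : ℤ × ℤ}
    (hu : u ∈ latticeBox B) :
    ∃ Q : Set (ℝ × ℝ), Q.Finite ∧ Detectable m (toReal u) Q (16 * s + 20) ∧
      ∀ y ∈ latticeBox B, y ≠ u →
        ∃ t : ℝ, 0 < t ∧ t ≤ 1 ∧ toReal u + t • (toReal y - toReal u) ∈ Q := by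
  set T := (slopes B).image fun t => (u.2 : ℝ) + t with hT
  have hTc : #T ≤ 2 ^ s := Finset.card_image_le.trans ((card_slopes_le B).trans hs)
  have hmem : ∀ a b : ℤ, 1 ≤ a → a ≤ 2 * B → -(2 * B) ≤ b → b ≤ 2 * B →
      (u.2 : ℝ) + (b : ℝ) / (a : ℝ) ∈ T := by
    intro a b h1 h2 h3 h4
    lift a to ℕ using by omega
    refine Finset.mem_image_of_mem _ (Finset.mem_image.2 ⟨(a, b), ?_, by simp⟩)
    simp only [Finset.mem_product, Finset.mem_Icc]
    omega
  refine ⟨(((fun t => ((u.1 : ℝ) + 1, t)) '' (T : Set ℝ)) ∪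
    ((fun t => ((u.1 : ℝ) - 1, t)) '' (T : Set ℝ))) ∪
    ({((u.1 : ℝ), (u.2 : ℝ) + 1)} ∪ {((u.1 : ℝ), (u.2 : ℝ) - 1)}), ?_, ?_, ?_⟩
  · exact ((T.finite_toSet.image _).union (T.finite_toSet.image _)).union
      ((Set.finite_singleton _).union (Set.finite_singleton _))
  · rw [show 16 * s + 20 = (8 * (s + 1) + 8 * (s + 1)) + (2 + 2) by ring]
    exact ((detectable_vertical _ _ T s hTc).union (detectable_vertical _ _ T s hTc)).union
      ((detectable_singleton _ _).union (detectable_singleton _ _))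
  · rintro y hy hyu
    simp only [latticeBox, Finset.mem_product, Finset.mem_Icc] at hy hu
    rcases lt_trichotomy u.1 y.1 with h | h | h
    · have h0 : (1 : ℝ) ≤ (y.1 : ℝ) - u.1 := by exact_mod_cast (by omega : 1 ≤ y.1 - u.1)
      refine ⟨1 / ((y.1 : ℝ) - u.1), by positivity, ?_, .inl (.inl ⟨_,
        hmem (y.1 - u.1) (y.2 - u.2) (by omega) (by omega) (by omega) (by omega), ?_⟩)⟩
      · rw [div_le_one (by positivity)]
        exact h0
      · ext
        · simp only [toReal, Prod.fst_add, Prod.smul_fst, Prod.fst_sub, smul_eq_mul]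
          field_simp
        · simp only [toReal, Prod.snd_add, Prod.smul_snd, Prod.snd_sub, smul_eq_mul]
          push_cast
          ring
    · have h2 : y.2 ≠ u.2 := fun h2 => hyu (Prod.ext h.symm h2)
      rcases lt_or_gt_of_ne h2 with h2 | h2
      · have h0 : (1 : ℝ) ≤ (u.2 : ℝ) - y.2 := by exact_mod_cast (by omega : 1 ≤ u.2 - y.2)
        refine ⟨1 / ((u.2 : ℝ) - y.2), by positivity, ?_, .inr (.inr ?_)⟩
        · rw [div_le_one (by positivity)]
          exact h0
        · rw [Set.mem_singleton_iff]
          ext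
          · simp [toReal, h]
          · simp only [toReal, Prod.snd_add, Prod.smul_snd, Prod.snd_sub, smul_eq_mul]
            field_simp
            ring
      · have h0 : (1 : ℝ) ≤ (y.2 : ℝ) - u.2 := by exact_mod_cast (by omega : 1 ≤ y.2 - u.2)
        refine ⟨1 / ((y.2 : ℝ) - u.2), by positivity, ?_, .inr (.inl ?_)⟩
        · rw [div_le_one (by positivity)]
          exact h0
        · rw [Set.mem_singleton_iff]
          ext
          · simp [toReal, h]
          · simp only [toReal, Prod.snd_add, Prod.smul_snd, Prod.snd_sub, smul_eq_mul]
            field_simp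
    · have h0 : (1 : ℝ) ≤ (u.1 : ℝ) - y.1 := by exact_mod_cast (by omega : 1 ≤ u.1 - y.1)
      refine ⟨1 / ((u.1 : ℝ) - y.1), by positivity, ?_, .inl (.inr ⟨_,
        hmem (u.1 - y.1) (y.2 - u.2) (by omega) (by omega) (by omega) (by omega), ?_⟩)⟩
      · rw [div_le_one (by positivity)]
        exact h0
      · ext
        · simp only [toReal, Prod.fst_add, Prod.smul_fst, Prod.fst_sub, smul_eq_mul]
          field_simp
          ring
        · simp only [toReal, Prod.snd_add, Prod.smul_snd, Prod.snd_sub, smul_eq_mul]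
          push_cast
          ring

/-! ### Minimization over lattice sets -/

/-- With `n` evaluations one can find a point of `F` of minimal rank, or that `F` is empty. -/
def Minimizable (m : ℕ) (F : Finset (ℤ × ℤ)) (n : ℕ) : Prop :=
  Solvable (m := m) n fun f g (o : Option (ℤ × ℤ)) => (o = none → F = ∅) ∧
    ∀ z, o = some z → z ∈ F ∧ ∀ w ∈ F, rank f g (toReal z) ≤ rank f g (toReal w)

theorem minimizable_singleton (z : ℤ × ℤ) : Minimizable m {z} 0 :=
  Solvable.pure 0 (some z) fun f g _ => by simp

theorem Minimizable.union {F₁ F₂ : Finset (ℤ × ℤ)} {n₁ n₂ : ℕ} (h₁ : Minimizable m F₁ n₁)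
    (h₂ : Minimizable m F₂ n₂) : Minimizable m (F₁ ∪ F₂) (n₁ + (n₂ + 2)) := by
  refine Solvable.bind h₁ fun o₁ => Solvable.bind h₂ fun o₂ => ?_
  rcases o₁ with _ | z₁
  · refine Solvable.pure _ o₂ fun f g _ h₂ h₁ => ?_
    simpa [h₁.1 rfl] using h₂
  rcases o₂ with _ | z₂
  · refine Solvable.pure _ (some z₁) fun f g _ h₂ h₁ => ?_
    simpa [h₂.1 rfl] using h₁
  refine (Solvable.compare (toReal z₁) (toReal z₂)).map fun b => ?_
  by_cases hb : b
  · refine ⟨some z₁, fun f g _ hbq h₂ h₁ => ⟨by simp, fun z hz => ?_⟩⟩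
    obtain rfl := Option.some.inj hz
    have hlt := hbq.1 hb
    obtain ⟨hm₁, hle₁⟩ := h₁.2 _ rfl
    obtain ⟨hm₂, hle₂⟩ := h₂.2 _ rfl
    refine ⟨Finset.mem_union_left _ hm₁, fun w hw => ?_⟩
    rcases Finset.mem_union.1 hw with hw | hw
    exacts [hle₁ w hw, hlt.le.trans (hle₂ w hw)]
  · refine ⟨some z₂, fun f g _ hbq h₂ h₁ => ⟨by simp, fun z hz => ?_⟩⟩
    obtain rfl := Option.some.inj hz
    have hle := not_lt.1 fun h => hb (hbq.2 h)
    obtain ⟨hm₁, hle₁⟩ := h₁.2 _ rfl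
    obtain ⟨hm₂, hle₂⟩ := h₂.2 _ rfl
    refine ⟨Finset.mem_union_right _ hm₂, fun w hw => ?_⟩
    rcases Finset.mem_union.1 hw with hw | hw
    exacts [hle.trans (hle₁ w hw), hle₂ w hw]

/-- The bound `hj` says that `j` cuts by the factor 3/4 leave fewer than one point. A round costs
`16 * s + 20` evaluations for the cut and 2 for comparing `u` with the best remaining point. -/
theorem MidClosed.minimizable_of_card {B s : ℕ} (hs : 2 * B * (4 * B + 1) ≤ 2 ^ s) (j : ℕ)
    {F : Finset (ℤ × ℤ)} (hF : MidClosed F) (hFB : F ⊆ latticeBox B) (hj : 3 ^ j * #F < 4 ^ j) :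
    Minimizable m F (j * (16 * s + 22)) := by
  induction j generalizing F with
  | zero =>
    have : F = ∅ := by simpa using hj
    exact Solvable.pure _ none fun f g _ => by simp [this]
  | succ j ih =>
    rcases F.eq_empty_or_nonempty with rfl | hne
    · exact Solvable.pure _ none fun f g _ => by simp
    obtain ⟨u, huF, hu⟩ := hF.exists_centerpoint hne
    obtain ⟨Q, hfin, hdet, hQ⟩ := exists_detectable_directions (m := m) hs (hFB huF)
    have hcut := hdet.cut hF hu hfin fun y hy => hQ y (hFB hy)
    rw [show (j + 1) * (16 * s + 22) = (16 * s + 20) + (0 + (j * (16 * s + 22) + 2)) by ring]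
    refine Solvable.bind hcut fun F' => ?_
    by_cases hF' : MidClosed F' ∧ F' ⊆ F ∧ 4 * #F' ≤ 3 * #F
    · obtain ⟨hmid, hsub, hcard⟩ := hF'
      have hmin : Minimizable m F' (j * (16 * s + 22)) := by
        refine ih hmid (hsub.trans hFB) ?_
        have h1 : 3 ^ j * (4 * #F') ≤ 3 ^ j * (3 * #F) := Nat.mul_le_mul_left _ hcard
        rw [pow_succ, pow_succ] at hj
        nlinarith
      refine Solvable.weaken ((minimizable_singleton u).union hmin) fun f g o _ ho hc => ?_
      refine ⟨fun hn => by simpa using ho.1 hn, fun z hz => ?_⟩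
      obtain ⟨hzF, hz⟩ := ho.2 z hz
      refine ⟨?_, fun w hw => ?_⟩
      · rcases Finset.mem_union.1 hzF with h | h
        · rwa [Finset.mem_singleton.1 h]
        · exact hsub h
      · rcases lt_or_ge (rank f g (toReal w)) (rank f g (toReal u)) with h | h
        · exact hz w (Finset.mem_union_right _ (hc.2.2.2 w hw h))
        · exact (hz u (by simp)).trans h
    · exact Solvable.pure _ none fun f g _ hc => absurd ⟨hc.1, hc.2.1, hc.2.2.1⟩ hF'

theorem MidClosed.filter_lex_lt {F : Finset (ℤ × ℤ)} (hF : MidClosed F) (x : ℤ × ℤ) :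
    MidClosed {y ∈ F | toLex y < toLex x} := by
  intro p hp q hq r hr
  rw [Finset.mem_filter, Prod.Lex.toLex_lt_toLex] at *
  refine ⟨hF p hp.1 q hq.1 r hr, ?_⟩
  have h1 := congrArg Prod.fst hr
  have h2 := congrArg Prod.snd hr
  simp only [Prod.fst_add, Prod.snd_add] at h1 h2
  omega

theorem MidClosed.filter_lex_gt {F : Finset (ℤ × ℤ)} (hF : MidClosed F) (x : ℤ × ℤ) :
    MidClosed {y ∈ F | toLex x < toLex y} := by
  intro p hp q hq r hr
  rw [Finset.mem_filter, Prod.Lex.toLex_lt_toLex] at *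
  refine ⟨hF p hp.1 q hq.1 r hr, ?_⟩
  have h1 := congrArg Prod.fst hr
  have h2 := congrArg Prod.snd hr
  simp only [Prod.fst_add, Prod.snd_add] at h1 h2
  omega

/-- The points outside `X` are split into intervals of the lexicographic order. -/
theorem minimizable_sdiff {n : ℕ} {R : Finset (ℤ × ℤ)}
    (hn : ∀ F ⊆ R, MidClosed F → Minimizable m F n) (X : Finset (ℤ × ℤ)) {F : Finset (ℤ × ℤ)}
    (hFR : F ⊆ R) (hF : MidClosed F) : Minimizable m (F \ X) ((#X + 1) * (n + 2)) := by
  induction X using Finset.induction_on_max_value (fun x : ℤ × ℤ => toLex x) generalizing F with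
  | empty =>
    rw [Finset.sdiff_empty]
    exact Solvable.mono (hn F hFR hF) (by rw [Finset.card_empty]; omega)
  | insert x X hx hmax ih =>
    -- As `x` is the lexicographic maximum, the part above it contains no point of `X`.
    have h : F \ insert x X = ({y ∈ F | toLex y < toLex x} \ X) ∪ {y ∈ F | toLex x < toLex y} := by
      ext y
      simp only [Finset.mem_sdiff, Finset.mem_insert, Finset.mem_union, Finset.mem_filter, not_or]
      constructor
      · rintro ⟨hy, hyx, hyX⟩
        rcases lt_or_gt_of_ne (toLex.injective.ne hyx) with h | h
        exacts [.inl ⟨⟨hy, h⟩, hyX⟩, .inr ⟨hy, h⟩]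
      · rintro (⟨⟨hy, h⟩, hyX⟩ | ⟨hy, h⟩)
        · exact ⟨hy, fun e => (e ▸ h).ne rfl, hyX⟩
        · exact ⟨hy, fun e => (e ▸ h).ne rfl, fun hyX => absurd (hmax y hyX) (not_le.2 h)⟩
    rw [h, Finset.card_insert_of_notMem hx,
      show (#X + 1 + 1) * (n + 2) = (#X + 1) * (n + 2) + (n + 2) by ring]
    exact (ih ((Finset.filter_subset _ _).trans hFR) (hF.filter_lex_lt x)).union
      (hn _ ((Finset.filter_subset _ _).trans hFR) (hF.filter_lex_gt x))

theorem midClosed_latticeBox (B : ℕ) : MidClosed (latticeBox B) := by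
  intro p hp q hq r hr
  have h1 := congrArg Prod.fst hr
  have h2 := congrArg Prod.snd hr
  simp only [latticeBox, Finset.mem_product, Finset.mem_Icc, Prod.fst_add, Prod.snd_add] at *
  omega

theorem mem_feasible_iff {B : ℕ} {g : Fin m → ℝ × ℝ → ℝ} {z : ℤ × ℤ} :
    z ∈ feasible g B ↔ toReal z ∈ constraintSet g ∧ z ∈ latticeBox B := by
  simp only [feasible, box, toReal, latticeBox, Set.mem_ofPred_eq, Set.mem_inter_iff, Set.mem_prod,
    Set.mem_Icc, Finset.mem_product, Finset.mem_Icc]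
  norm_cast

/-- The number of evaluations that suffice to find a next best point after `n` points. -/
theorem solvable_nextBestPoint {B : ℕ} (hB : 1 ≤ B) {n : ℕ} (x : Fin n → ℤ × ℤ) {s : ℕ}
    (hs : s = 6 + 2 * Nat.log 2 B) :
    Solvable (m := m) ((n + 1) * (3 * s * (16 * s + 22) + 2) + 1)
      fun f g (o : Option (ℤ × ℤ)) =>
        (∀ z, o = some z → IsNextBestPoint f (feasible g B) x z) ∧
        (o = none → ¬ ∃ z, IsNextBestPoint f (feasible g B) x z) := by
  -- This bounds both the number of slopes, at most `10 * B ^ 2`, and the size of the box, at most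
  -- `9 * B ^ 2`.
  have hBs : 16 * B ^ 2 ≤ 2 ^ s := by
    have h1 := (Nat.lt_pow_succ_log_self (b := 2) (by norm_num) B).le
    calc 16 * B ^ 2 ≤ 2 ^ 4 * (2 ^ (Nat.log 2 B + 1)) ^ 2 := by gcongr; norm_num
      _ = 2 ^ s := by rw [hs, ← pow_mul, ← pow_add]; congr 1; ring
  have hbox : ∀ F ⊆ latticeBox B, MidClosed F → Minimizable m F (3 * s * (16 * s + 22)) := by
    intro F hFB hF
    refine hF.minimizable_of_card (by nlinarith) (3 * s) hFB ?_
    have hc : #F ≤ 2 ^ s := by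
      refine (Finset.card_le_card hFB).trans ?_
      rw [latticeBox, Finset.card_product, Int.card_Icc,
        show (B + 1 - -(B : ℤ)).toNat = 2 * B + 1 by omega]
      nlinarith
    -- Three cuts more than halve a set, since `27 * 2 < 64`; hence `3 * s` rounds suffice.
    rw [pow_mul, pow_mul]
    calc (3 ^ 3) ^ s * #F ≤ (3 ^ 3) ^ s * 2 ^ s := Nat.mul_le_mul_left _ hc
      _ = (3 ^ 3 * 2) ^ s := (mul_pow _ _ _).symm
      _ < (4 ^ 3) ^ s := Nat.pow_lt_pow_left (by norm_num) (by omega)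
  have hX : #(Finset.univ.image x) ≤ n := Finset.card_image_le.trans (by simp)
  refine Solvable.bind (n₂ := 1) (Solvable.mono (minimizable_sdiff hbox (Finset.univ.image x)
    subset_rfl (midClosed_latticeBox B)) (Nat.mul_le_mul_right _ (by omega))) fun o => ?_
  have hmem : ∀ (g : Fin m → ℝ × ℝ → ℝ) z, z ∈ feasible g B \ Set.range x ↔
      toReal z ∈ constraintSet g ∧ z ∈ latticeBox B \ Finset.univ.image x := by
    intro g z
    rw [Set.mem_sdiff, mem_feasible_iff, Finset.mem_sdiff, and_assoc]
    simp
  rcases o with _ | z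
  · refine Solvable.pure _ none fun f g _ h => ⟨by simp, fun _ => ?_⟩
    rintro ⟨z, hz, -⟩
    rw [hmem, h.1 rfl] at hz
    simp at hz
  refine (Solvable.feasible (toReal z)).map fun b => ?_
  by_cases hb : b
  · refine ⟨some z, fun f g _ hbq h => ⟨fun z' hz' => ?_, by simp⟩⟩
    obtain rfl := Option.some.inj hz'
    obtain ⟨hzF, hzmin⟩ := h.2 _ rfl
    refine ⟨(hmem g _).2 ⟨hbq.1 hb, hzF⟩, fun w hw => ?_⟩
    obtain ⟨hwS, hwF⟩ := (hmem g w).1 hw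
    have := hzmin w hwF
    simpa [rank, Prod.Lex.toLex_le_toLex, violation_eq_zero_iff.2 hwS,
      violation_eq_zero_iff.2 (hbq.1 hb)] using this
  -- If the point of least rank is infeasible, no remaining point has violation 0.
  · refine ⟨none, fun f g _ hbq h => ⟨by simp, fun _ => ?_⟩⟩
    rintro ⟨w, hw, -⟩
    obtain ⟨hwS, hwF⟩ := (hmem g w).1 hw
    have := (h.2 _ rfl).2 w hwF
    refine hb (hbq.2 (violation_eq_zero_iff.1 (le_antisymm ?_ (violation_nonneg _ _))))
    simp only [rank, Prod.Lex.toLex_le_toLex, violation_eq_zero_iff.2 hwS] at this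
    rcases this with h | h
    exacts [h.le, h.1.le]

end Minimize

/-! ### The polynomial bound -/

/-- The factor 2 comes from `Real.log 2 > 1 / 2`. -/
theorem natLog_two_le (B : ℕ) (hB : 1 ≤ B) : (Nat.log 2 B : ℝ) ≤ 2 * Real.log B := by
  have h1 : ((2 ^ Nat.log 2 B : ℕ) : ℝ) ≤ B := by
    exact_mod_cast Nat.pow_log_le_self 2 (by omega)
  have h2 := Real.log_le_log (by positivity) h1
  push_cast at h2
  rw [Real.log_pow] at h2
  nlinarith [Real.log_two_gt_d9, (Nat.cast_nonneg (Nat.log 2 B) : (0 : ℝ) ≤ _)]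

end KthBest

open KthBest MvPolynomial in
theorem mainTheorem2 :
    ∃ (p : MvPolynomial (Fin 2) ℝ)
      (A : ∀ m _B k : ℕ, (Fin (k - 1) → ℤ × ℤ) → KthBest.EvalAlgorithm m (Option (ℤ × ℤ))),
      ∀ (m B k : ℕ), 1 ≤ B → 2 ≤ k →
      ∀ (f : ℝ × ℝ → ℝ) (g : Fin m → ℝ × ℝ → ℝ),
        ConvexOn ℝ Set.univ f → (∀ i, ConvexOn ℝ Set.univ (g i)) →
      ∀ x : Fin (k - 1) → ℤ × ℤ, KthBest.AreBestPoints f (KthBest.feasible g B) x →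
        (((A m B k x).numEvals f g : ℕ) : ℝ) ≤ MvPolynomial.eval ![Real.log (B : ℝ), (k : ℝ)] p ∧
        (∀ z, (A m B k x).run f g = some z →
          KthBest.IsNextBestPoint f (KthBest.feasible g B) x z) ∧
        ((A m B k x).run f g = none →
          ¬ ∃ z, KthBest.IsNextBestPoint f (KthBest.feasible g B) x z) := by
  have key := fun (m B k : ℕ) (x : Fin (k - 1) → ℤ × ℤ) (hB : 1 ≤ B) =>
    solvable_nextBestPoint (m := m) hB x rfl
  replace key : ∀ (m B k : ℕ) (x : Fin (k - 1) → ℤ × ℤ),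
      ∃ A : EvalAlgorithm m (Option (ℤ × ℤ)), 1 ≤ B → _ := fun m B k x => by
    by_cases hB : 1 ≤ B
    · exact (key m B k x hB).imp fun _ hA _ => hA
    · exact ⟨.output none, fun h => absurd h hB⟩
  choose A hA using key
  -- The evaluation count with `n + 1 = k` and `s` replaced by its upper bound `6 + 4 * Real.log B`.
  refine ⟨X 1 * (3 * (6 + 4 * X 0) * (16 * (6 + 4 * X 0) + 22) + 2) + 1, A, ?_⟩
  intro m B k hB hk f g hf hg x _
  obtain ⟨h1, h2⟩ := hA m B k x hB f g ⟨hf, hg⟩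
  refine ⟨?_, h2⟩
  rw [Nat.sub_add_cancel (by omega : 1 ≤ k)] at h1
  have h3 := natLog_two_le B hB
  have h4 : ((6 + 2 * Nat.log 2 B : ℕ) : ℝ) ≤ 6 + 4 * Real.log B := by
    push_cast
    linarith
  have h5 := (Nat.cast_le (α := ℝ)).2 h1
  refine h5.trans ?_
  simp only [map_add, map_mul, eval_X, map_ofNat, map_one, Matrix.cons_val_zero,
    Matrix.cons_val_one]
  generalize 6 + 2 * Nat.log 2 B = s at h4 ⊢
  push_cast
  gcongr
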